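/- **Setting.** Logarithms are to base $2$. Let $\mathbb S_O$ be a finite set of semantic states (ground atoms) with a fixed linear "canonical" order and a proof system; $\mathrm{Cn}(\Gamma)$ is the set of states derivable from $\Gamma\subseteq\mathbb S_O$. The irredundant core $\mathrm{Atom}(S)$ of $S\subseteq\mathbb S_O$ is obtained by scanning $S$ in canonical order and deleting each $s$ that is derivable from the other elements of the current set. The closure fidelity is $\mathsf F_{\mathrm{Cn}}(S,T)=|\mathrm{Cn}(S)\cap\mathrm{Cn}(T)|/|\mathrm{Cn}(S)\cup\mathrm{Cn}(T)|$ (with $0/0=1$), and the closure distortion relative to $\Gamma$ is $d_{\mathrm{Cn}}(s,t\mid\Gamma)=1-\mathsf F_{\mathrm{Cn}}\big((\Gamma\setminus\{s\})\cup\{s\},(\Gamma\setminus\{s\})\cup\{t\}\big)$. A *broadcast scenario* consists of such a universe, a sender knowledge base $S_O^{(0)}\subseteq\mathbb S_O$ with core $A^{(0)}=\mathrm{Atom}(S_O^{(0)})$, and $K\ge 1$ receiver knowledge bases $S_O^{(1)},\dots,S_O^{(K)}\subseteq\mathbb S_O$. Let $W$ be a discrete memoryless channel with finite alphabets $S_C,\hat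 S_C$ and Shannon capacity $C(W)>0$; all receivers observe the same output of $W$. A *broadcast code* of blocklength $n$ for the scenario has one common encoder $f_n:S_O^{(0)}\to S_C^n$ and decoders $g_n^{(j)}:\hat S_C^n\to S_O^{(j)}$; its closure error $P_{e,\mathrm{Cn}}^{(n,j)}$ at receiver $j$ is the maximum over $m\in S_O^{(0)}$ of the probability that $d_{\mathrm{Cn}}(m,g_n^{(j)}(\hat{\mathsf S}_C^n)\mid S_O^{(0)})>0$ when $f_n(m)$ is sent. The code is *two-layer* if there are $f^A:A^{(0)}\to S_C^n$, $g^A:\hat S_C^n\to A^{(0)}$ and $a_0\in A^{(0)}$ such that $f_n=f^A$ on $A^{(0)}$, $f_n(m)=f^A(a_0)$ for $m\in S_O^{(0)}\setminus A^{(0)}$, and $g_n^{(j)}=g^A$ for all $j$. Let $n^*_{\mathrm{bc}}(\epsilon)$ be the least $n$ for which a (not necessarily two-layer) broadcast code with $\max_jP_{e,\mathrm{Cn}}^{(n,j)}\le\epsilon$ exists. *Core-disjointness* means: for each $j$ and all distinct $a_1,a_2\in A^{(0)}$ there is no $t\in S_O^{(j)}$ with $d_{\mathrm{Cn}}(a_1,t\mid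 S_O^{(0)})=d_{\mathrm{Cn}}(a_2,t\mid S_O^{(0)})=0$. **Theorem (Broadcast deductive compression).** Fix $W$ with $C(W)>0$, and consider broadcast scenarios such that for every receiver $j$: (BH1) $A^{(0)}\subseteq S_O^{(j)}$; (BH2) $S_O^{(j)}\setminus S_O^{(0)}\subseteq\mathrm{Cn}(S_O^{(0)})$. In (ii) and (iii) assume also $A^{(0)}\neq\varnothing$. (i) $\mathsf F_{\mathrm{Cn}}(S_O^{(0)},S_O^{(j)})=1$ for every $j$. (ii) For each scenario there is a single sequence of two-layer broadcast codes, of blocklengths $n=0,1,2,\dots$, with $P_{e,\mathrm{Cn}}^{(n,j)}\to0$ for all $j$. Moreover, for every $R<C(W)$ there is a sequence $\eta_n\to0$, depending only on $W$ and $R$, such that for every $n\ge1$ and every scenario (with any $K$) with $\log|A^{(0)}|/n\le R$ there is a two-layer broadcast code of blocklength $n$ with $P_{e,\mathrm{Cn}}^{(n,j)}\le\eta_n$ for all $j$. (iii) Let $0<\epsilon<1$. Then $n^*_{\mathrm{bc}}(\epsilon)$ exists, and for every $\delta\in(0,C(W))$ there is $L$, depending only on $W,\epsilon,\delta$, with $$n^*_{\mathrm{bc}}(\epsilon)\le\left\lceil\frac{\log|A^{(0)}|}{C(W)-\delta}\right\rceil\quad\text{whenever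 }|A^{(0)}|\ge L.$$ Under core-disjointness, $$\frac{(1-\epsilon)\log|A^{(0)}|-1}{C(W)}\le n^*_{\mathrm{bc}}(\epsilon),$$ and $n^*_{\mathrm{bc}}(\epsilon)$ depends only on $W$, $\epsilon$ and $|A^{(0)}|$: it is the same for any two core-disjoint scenarios with equal $|A^{(0)}|$, whatever their numbers of receivers. In particular $n^*_{\mathrm{bc}}\approx\log|A^{(0)}|/C(W)$: for every $\gamma>0$ there is $\epsilon_0>0$ such that for each $\epsilon\in(0,\epsilon_0)$ there is $L$ with $\big|\,n^*_{\mathrm{bc}}(\epsilon)\,C(W)/\log|A^{(0)}|-1\big|\le\gamma$ for all core-disjoint scenarios with $|A^{(0)}|\ge L$. (iv) Under core-disjointness, every broadcast code of blocklength $n$ with $\max_jP_{e,\mathrm{Cn}}^{(n,j)}\le\epsilon<1$ satisfies $\log|A^{(0)}|\le(nC(W)+1)/(1-\epsilon)$. -/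

import Mathlib

universe u v w

open Filter Topology

namespace SemanticBroadcast

/-! ### Proof systems, deductive closure, irredundant core -/

/-- A proof system on a set `U` of ground atoms, given by its inference rules: `Rule P s` says that
`s` is derivable in one step from the finite set of premises `P`. -/
structure ProofSystem (U : Type*) where
  Rule : Finset U → U → Prop

namespace ProofSystem

variable {U : Type*} (PS : ProofSystem U)

/-- Derivability from the set of premises `Γ`. -/
inductive Derivable (Γ : Set U) : U → Prop
  | premise (s : U) : s ∈ Γ → Derivable Γ s
  | step (P : Finset U) (s : U) : PS.Rule P s → (∀ p ∈ P, Derivable Γ p) → Derivable Γ s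

/-- The deductive closure operator. -/
def Cn (Γ : Set U) : Set U := {s | PS.Derivable Γ s}

theorem subset_Cn (Γ : Set U) : Γ ⊆ PS.Cn Γ := fun s hs => Derivable.premise s hs

theorem Cn_mono {Γ Γ' : Set U} (h : Γ ⊆ Γ') : PS.Cn Γ ⊆ PS.Cn Γ' := by
  intro s hs
  induction hs with
  | premise s hs => exact Derivable.premise s (h hs)
  | step P s hr _ ih => exact Derivable.step P s hr ih

theorem Cn_idem (Γ : Set U) : PS.Cn (PS.Cn Γ) = PS.Cn Γ := by
  apply Set.Subset.antisymm _ (PS.subset_Cn _)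
  intro s hs
  induction hs with
  | premise s hs => exact hs
  | step P s hr _ ih => exact Derivable.step P s hr ih

open Classical in
/-- The irredundant core `Atom(S)`: scan the elements of `S` in increasing (canonical) order and
delete each `s` that is derivable from the remaining other elements of the current set. -/
noncomputable def atom [LinearOrder U] (S : Finset U) : Finset U :=
  (S.sort (· ≤ ·)).foldl
    (fun A s => if s ∈ PS.Cn ((A.erase s : Finset U) : Set U) then A.erase s else A) S

open Classical in
/-- Closure fidelity: the Jaccard index of the two deductive closures, with `0 / 0 = 1`. -/
noncomputable def closureFidelity (S T : Set U) : ℝ :=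
  if PS.Cn S ∪ PS.Cn T = ∅ then 1
  else ((PS.Cn S ∩ PS.Cn T).ncard : ℝ) / ((PS.Cn S ∪ PS.Cn T).ncard : ℝ)

/-- Closure distortion `d_Cn(s, t ∣ Γ)`: the Jaccard distance between the closures of
`(Γ \ {s}) ∪ {s}` and of `(Γ \ {s}) ∪ {t}`, with `0 / 0 = 1` in the Jaccard index. -/
noncomputable def closureDistortion (Γ : Set U) (s t : U) : ℝ :=
  1 - PS.closureFidelity ((Γ \ {s}) ∪ {s}) ((Γ \ {s}) ∪ {t})

end ProofSystem

/-! ### Discrete memoryless channels -/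

section Channel

variable {X Y : Type*} [Fintype X] [Fintype Y]

/-- Mutual information, in bits, of input and output of the channel `W` under the input
distribution `P`. -/
noncomputable def mutualInfo (P : stdSimplex ℝ X) (W : X → stdSimplex ℝ Y) : ℝ :=
  ∑ x, ∑ y, P x * W x y * Real.logb 2 (W x y / ∑ x', P x' * W x' y)

/-- Shannon capacity, in bits per channel use. -/
noncomputable def capacity (W : X → stdSimplex ℝ Y) : ℝ :=
  ⨆ P : stdSimplex ℝ X, mutualInfo P W

/-- Transition probability `W^{⊗n}(y ∣ x)` of the `n`-fold memoryless extension. -/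
noncomputable def memoryless (W : X → stdSimplex ℝ Y) {n : ℕ} (x : Fin n → X) (y : Fin n → Y) : ℝ :=
  ∏ i, W (x i) (y i)

open Classical in
/-- The probability that the channel output lies in `E` when the word `x` is sent. -/
noncomputable def outputProb (W : X → stdSimplex ℝ Y) {n : ℕ} (x : Fin n → X)
    (E : Set (Fin n → Y)) : ℝ :=
  ∑ y, if y ∈ E then memoryless W x y else 0

end Channel

/-! ### The broadcast scenario -/

/-- One sender and `K ≥ 1` receivers with finite knowledge bases in a common finite ambient
universe of semantic states, which carries a canonical order and a common proof system. -/
structure Scenario : Type (u + 1) where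
  State : Type u
  [finite : Finite State]
  [order : LinearOrder State]
  PS : ProofSystem State
  K : ℕ
  one_le_K : 1 ≤ K
  sender : Finset State
  receiver : Fin K → Finset State

attribute [instance] Scenario.finite Scenario.order

namespace Scenario

variable (B : Scenario)

/-- The irredundant core of the sender. -/
noncomputable def core : Finset B.State := B.PS.atom B.sender

/-- Sender core elements that are missing in the vocabulary of receiver `j`. -/
def lostCore (j : Fin B.K) : Set B.State := (B.core : Set B.State) \ B.receiver j

/-- Surplus states of receiver `j`. -/
def surplus (j : Fin B.K) : Set B.State := (B.receiver j : Set B.State) \ B.sender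

/-- Surplus states of receiver `j` that the sender cannot derive. -/
def nonderivableSurplus (j : Fin B.K) : Set B.State := B.surplus j \ B.PS.Cn B.sender

/-- Every receiver covers the sender core and has only derivable surplus. -/
def OverlapConditions : Prop :=
  (∀ j, B.lostCore j = ∅) ∧ (∀ j, B.nonderivableSurplus j = ∅)

/-- The reconstructions in the vocabulary of receiver `j` at zero closure distortion from `m`. -/
def zeroDistortion (j : Fin B.K) (m : B.State) : Set B.State :=
  {t | t ∈ B.receiver j ∧ B.PS.closureDistortion B.sender m t = 0}

/-- Deductive independence of the sender core, with respect to every receiver vocabulary. -/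
def CoreDisjoint : Prop :=
  ∀ j, ∀ a₁ ∈ B.core, ∀ a₂ ∈ B.core, a₁ ≠ a₂ →
    Disjoint (B.zeroDistortion j a₁) (B.zeroDistortion j a₂)

end Scenario

/-- A broadcast semantic block code of blocklength `n` with the whole sender knowledge base as its
message set: one common encoder, and for each receiver a decoder into its own vocabulary. -/
structure BroadcastCode (X Y : Type*) (B : Scenario) (n : ℕ) where
  enc : B.sender → (Fin n → X)
  dec : (j : Fin B.K) → (Fin n → Y) → B.receiver j

namespace BroadcastCode

variable {X Y : Type*} {B : Scenario} {n : ℕ}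

/-- A two-layer code: a code `(fA, gA)` for the core, whose encoder is extended to all other
messages by the codeword of one fixed core element `a₀`, and whose decoder all receivers use. -/
def IsTwoLayer (c : BroadcastCode X Y B n) : Prop :=
  ∃ (fA : B.core → (Fin n → X)) (gA : (Fin n → Y) → B.core) (a₀ : B.core),
    (∀ m : B.sender, c.enc m = if h : m.1 ∈ B.core then fA ⟨m.1, h⟩ else fA a₀) ∧
    (∀ j y, ((c.dec j y : B.receiver j) : B.State) = gA y)

variable [Fintype X] [Fintype Y]

/-- The closure error probability at receiver `j`: the maximum over all messages `m` of the
probability that the reconstruction has positive closure distortion from `m`, relative to the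
knowledge base of the sender. -/
noncomputable def closureError (W : X → stdSimplex ℝ Y) (c : BroadcastCode X Y B n)
    (j : Fin B.K) : ℝ :=
  ⨆ m : B.sender, outputProb W (c.enc m)
    {y | 0 < B.PS.closureDistortion B.sender m (c.dec j y : B.receiver j)}

end BroadcastCode

section Blocklength

variable {X Y : Type*} [Fintype X] [Fintype Y]

/-- The blocklengths at which some broadcast code has closure error at most `ε` at all receivers. -/
def achievableBlocklengths (W : X → stdSimplex ℝ Y) (B : Scenario) (ε : ℝ) : Set ℕ :=
  {n | ∃ c : BroadcastCode X Y B n, ∀ j, c.closureError W j ≤ ε}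

/-- The minimum blocklength for broadcast closure reliability at level `ε`. -/
noncomputable def minBlocklength (W : X → stdSimplex ℝ Y) (B : Scenario) (ε : ℝ) : ℕ :=
  sInf (achievableBlocklengths W B ε)

end Blocklength

end SemanticBroadcast

open SemanticBroadcast

/-! The scenario reduces to ordinary channel coding with `|A|` messages, `A` being the sender's
core. Pruning never changes the closure, so `A` generates `Cn(S)`. If `m ∈ S` is not in `A`,
deleting `m` leaves `A` intact, and any core element replaces `m` at zero distortion. Only core
elements must be transmitted, and since every receiver contains `A` and sees the same output, one
decoder serves all (`HasCode.exists_isTwoLayer`). Conversely, under core-disjointness the outputs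
that one receiver decodes without distortion from `a` form disjoint regions as `a` varies, so every
broadcast code is a channel code for `A` (`BroadcastCode.hasCode`).

What remains is the channel coding theorem for the maximal error. Achievability
(`exists_hasCode_of_lt_capacity`) combines Feinstein's greedy construction with a Chernoff bound on
the information density. The converse (`HasCode.converse`) compares the outputs of the codewords
with the product of the averaged output marginals; the divergence splits over positions into mutual
informations, each at most the capacity. -/

namespace SemanticBroadcast

/-! ### Product distributions -/

theorem sum_prod_mul_apply {ι Y : Type*} [Fintype ι] [DecidableEq ι] [Fintype Y]
    (w : ι → Y → ℝ) (hw : ∀ i, ∑ b, w i b = 1) (i : ι) (g : Y → ℝ) :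
    ∑ y : ι → Y, (∏ k, w k (y k)) * g (y i) = ∑ b, w i b * g b := by
  have h (y : ι → Y) : (∏ k, w k (y k)) * g (y i) =
      ∏ k, w k (y k) * (if k = i then g (y k) else 1) := by
    rw [Finset.prod_mul_distrib]
    simp
  simp_rw [h]
  rw [← Fintype.prod_sum (fun k b => w k b * (if k = i then g b else 1)),
    Fintype.prod_eq_single i]
  · simp
  · intro k hk
    simp [hk, hw]

/-- Chain rule for the divergence of product distributions. -/
theorem sum_prod_mul_logb_prod {ι Y : Type*} [Fintype ι] [DecidableEq ι] [Fintype Y]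
    (w q : ι → Y → ℝ) (hw : ∀ i, ∑ b, w i b = 1) (hq : ∀ i b, w i b ≠ 0 → q i b ≠ 0) :
    ∑ y : ι → Y, (∏ k, w k (y k)) * Real.logb 2 ((∏ k, w k (y k)) / ∏ k, q k (y k)) =
      ∑ i, ∑ b, w i b * Real.logb 2 (w i b / q i b) := by
  have h (y : ι → Y) :
      (∏ k, w k (y k)) * Real.logb 2 ((∏ k, w k (y k)) / ∏ k, q k (y k)) =
        ∑ i, (∏ k, w k (y k)) * Real.logb 2 (w i (y i) / q i (y i)) := by
    by_cases h0 : ∏ k, w k (y k) = 0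
    · simp [h0]
    · have h1 : ∀ k, w k (y k) ≠ 0 := by simpa [Finset.prod_eq_zero_iff] using h0
      rw [← Finset.prod_div_distrib, Real.logb_prod, Finset.mul_sum]
      exact fun k _ => div_ne_zero (h1 k) (hq k _ (h1 k))
  simp_rw [h]
  rw [Finset.sum_comm]
  exact Finset.sum_congr rfl fun i _ =>
    sum_prod_mul_apply w hw i fun b => Real.logb 2 (w i b / q i b)

/-! ### Memoryless channels, channel codes and capacity -/

section Channel

variable {X : Type v} {Y : Type w} [Fintype Y] (W : X → stdSimplex ℝ Y)

theorem memoryless_nonneg {n : ℕ} (x : Fin n → X) (y : Fin n → Y) : 0 ≤ memoryless W x y :=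
  Finset.prod_nonneg fun _ _ => stdSimplex.zero_le _ _

theorem sum_memoryless {n : ℕ} (x : Fin n → X) : ∑ y, memoryless W x y = 1 := by
  unfold memoryless
  rw [← Fintype.prod_sum (fun i b => W (x i) b)]
  simp

theorem outputProb_nonneg {n : ℕ} (x : Fin n → X) (E : Set (Fin n → Y)) :
    0 ≤ outputProb W x E := by
  unfold outputProb
  refine Finset.sum_nonneg fun y _ => ?_
  split_ifs
  exacts [memoryless_nonneg W x y, le_rfl]

theorem outputProb_mono {n : ℕ} (x : Fin n → X) {E F : Set (Fin n → Y)} (h : E ⊆ F) :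
    outputProb W x E ≤ outputProb W x F := by
  classical
  unfold outputProb
  refine Finset.sum_le_sum fun y _ => ?_
  by_cases hE : y ∈ E
  · simp [hE, h hE]
  · simp only [hE, if_false]
    split_ifs
    exacts [memoryless_nonneg W x y, le_rfl]

theorem outputProb_add_compl {n : ℕ} (x : Fin n → X) (E : Set (Fin n → Y)) :
    outputProb W x E + outputProb W x Eᶜ = 1 := by
  classical
  rw [← sum_memoryless W x, outputProb, outputProb, ← Finset.sum_add_distrib]
  refine Finset.sum_congr rfl fun y _ => ?_
  by_cases h : y ∈ E <;> simp [h]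

/-- A channel code of blocklength `n` with `M` codewords and maximal error probability at most
`ε`, given by its codewords and disjoint decoding regions. -/
def HasCode (n M : ℕ) (ε : ℝ) : Prop :=
  ∃ (x : Fin M → Fin n → X) (D : Fin M → Set (Fin n → Y)),
    (∀ i j, i ≠ j → Disjoint (D i) (D j)) ∧ ∀ i, outputProb W (x i) (D i)ᶜ ≤ ε

variable {W} [Fintype X]

theorem nonempty_of_capacity_pos (hW : 0 < capacity W) : Nonempty (stdSimplex ℝ X) := by
  by_contra h
  rw [not_nonempty_iff] at h
  simp [capacity, Real.iSup_of_isEmpty] at hW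

theorem mutualInfo_le_capacity (hW : 0 < capacity W) (P : stdSimplex ℝ X) :
    mutualInfo P W ≤ capacity W := by
  refine le_ciSup (f := fun P : stdSimplex ℝ X => mutualInfo P W) ?_ P
  -- An unbounded real supremum is `0` by convention, so positive capacity already forces
  -- boundedness.
  by_contra h
  rw [capacity, Real.iSup_of_not_bddAbove h] at hW
  exact lt_irrefl _ hW

/-! ### The converse -/

/-- This is `log z ≥ 1 - 1/z` at `z = p / (q c)`. The number `c` is a guess for the likelihood ratio
`p / q`; the correction term is harmless after summation when the total of `q c` does not exceed
that of `p`. -/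
theorem mul_logb_add_le_mul_logb_div {p q c : ℝ} (hp : 0 ≤ p) (hq : 0 ≤ q) (hpq : p ≠ 0 → q ≠ 0)
    (hc : 0 < c) :
    p * Real.logb 2 c + (p - q * c) / Real.log 2 ≤ p * Real.logb 2 (p / q) := by
  have hl : 0 < Real.log 2 := Real.log_pos one_lt_two
  rcases hp.eq_or_lt with rfl | hp
  · simp only [zero_mul, zero_sub, zero_add]
    exact div_nonpos_of_nonpos_of_nonneg (by nlinarith) hl.le
  have hq : 0 < q := lt_of_le_of_ne hq (hpq hp.ne').symm
  have h := Real.one_sub_inv_le_log_of_pos (x := p / q / c) (by positivity)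
  rw [Real.log_div (by positivity) hc.ne'] at h
  have h2 : p - q * c ≤ p * (Real.log (p / q) - Real.log c) := by
    have := mul_le_mul_of_nonneg_left h hp.le
    refine le_trans (le_of_eq ?_) this
    field_simp
  simp only [Real.logb, ← mul_div_assoc]
  rw [← add_div]
  exact div_le_div_of_nonneg_right (by linarith) hl.le

/-- Finite blocklength weak converse of the channel coding theorem, for the average divergence
of the output distributions from a fixed distribution. -/
theorem sub_one_mul_le_sum_divergence {B : Type*} [Fintype B] {M : ℕ} (hM : 0 < M) {ε : ℝ}
    (V : Fin M → B → ℝ) (Q : B → ℝ) (hV : ∀ m b, 0 ≤ V m b) (hV1 : ∀ m, ∑ b, V m b = 1)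
    (hQ : ∀ b, 0 ≤ Q b) (hQ1 : ∑ b, Q b = 1) (hVQ : ∀ m b, V m b ≠ 0 → Q b ≠ 0)
    (D : Fin M → Finset B) (hD : ∀ i j, i ≠ j → Disjoint (D i) (D j))
    (hε : ∀ m, 1 - ε ≤ ∑ b ∈ D m, V m b) :
    ((1 - ε) * Real.logb 2 M - 1) * M ≤ ∑ m, ∑ b, V m b * Real.logb 2 (V m b / Q b) := by
  classical
  have hl : 0 < Real.log 2 := Real.log_pos one_lt_two
  have hM' : (0 : ℝ) < M := by exact_mod_cast hM
  have hM1 : (1 : ℝ) ≤ M := by exact_mod_cast hM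
  have hlog : 0 ≤ Real.logb 2 M := Real.logb_nonneg one_lt_two hM1
  -- The guessed likelihood ratio rewards correct decoding by a factor `M`. The factor `1/2` costs
  -- the one bit in the bound and keeps the total of `Q * c` at most `M`: the constant part gives `M
  -- / 2`, and the disjoint decoding regions give at most another `M / 2`.
  set c : Fin M → B → ℝ := fun m b => if b ∈ D m then (M : ℝ) / 2 else 1 / 2 with hc
  have hcpos (m b) : 0 < c m b := by simp only [hc]; split_ifs <;> positivity
  have h1 (m) : (1 - ε) * Real.logb 2 M - 1 ≤ ∑ b, V m b * Real.logb 2 (c m b) := by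
    have hb (b) : V m b * Real.logb 2 (c m b) =
        (if b ∈ D m then V m b else 0) * Real.logb 2 M - V m b := by
      simp only [hc]
      split_ifs
      · rw [Real.logb_div hM'.ne' two_ne_zero, Real.logb_self_eq_one one_lt_two]; ring
      · rw [one_div, Real.logb_inv, Real.logb_self_eq_one one_lt_two]; ring
    simp_rw [hb]
    rw [Finset.sum_sub_distrib, ← Finset.sum_mul, hV1, ← Finset.sum_filter,
      Finset.filter_mem_eq_inter, Finset.univ_inter]
    have := mul_le_mul_of_nonneg_right (hε m) hlog
    linarith
  have h2 : ∑ m, ∑ b, Q b * c m b ≤ M := by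
    have hmb (m b) : Q b * c m b ≤ Q b / 2 + (if b ∈ D m then Q b else 0) * (M / 2) := by
      have := hQ b
      simp only [hc]
      split_ifs
      · linarith
      · linarith
    have hun : ∑ m, ∑ b, (if b ∈ D m then Q b else 0) ≤ 1 := by
      simp_rw [← Finset.sum_filter, Finset.filter_mem_eq_inter, Finset.univ_inter]
      rw [← Finset.sum_biUnion (fun i _ j _ h => hD i j h), ← hQ1]
      exact Finset.sum_le_univ_sum_of_nonneg hQ
    calc ∑ m, ∑ b, Q b * c m b
        ≤ ∑ m : Fin M, ∑ b, (Q b / 2 + (if b ∈ D m then Q b else 0) * (M / 2)) :=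
          Finset.sum_le_sum fun m _ => Finset.sum_le_sum fun b _ => hmb m b
      _ = M / 2 + (∑ m, ∑ b, (if b ∈ D m then Q b else 0)) * (M / 2) := by
          simp_rw [Finset.sum_add_distrib, ← Finset.sum_mul, ← Finset.sum_div, hQ1]
          simp [div_eq_mul_inv]
      _ ≤ M := by nlinarith
  have h3 : ∑ m, ∑ b, (V m b * Real.logb 2 (c m b) + (V m b - Q b * c m b) / Real.log 2) ≤
      ∑ m, ∑ b, V m b * Real.logb 2 (V m b / Q b) :=
    Finset.sum_le_sum fun m _ => Finset.sum_le_sum fun b _ =>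
      mul_logb_add_le_mul_logb_div (hV m b) (hQ b) (hVQ m b) (hcpos m b)
  refine le_trans ?_ h3
  simp_rw [Finset.sum_add_distrib, ← Finset.sum_div, Finset.sum_sub_distrib, hV1]
  have h4 : ((1 - ε) * Real.logb 2 M - 1) * M ≤ ∑ m, ∑ b, V m b * Real.logb 2 (c m b) := by
    have := Finset.sum_le_sum fun m (_ : m ∈ Finset.univ) => h1 m
    simpa only [Finset.sum_const, Finset.card_univ, Fintype.card_fin, nsmul_eq_mul,
      mul_comm (M : ℝ)] using this
  have h5 : 0 ≤ (∑ m : Fin M, (1 : ℝ) - ∑ m, ∑ b, Q b * c m b) / Real.log 2 :=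
    div_nonneg (by simpa using h2) hl.le
  linarith

/-- The uniform distribution on the codeword symbols at one position. -/
noncomputable def empirical {M : ℕ} (hM : 0 < M) (x : Fin M → X) : stdSimplex ℝ X := by
  classical
  refine ⟨fun a => ∑ m, (M : ℝ)⁻¹ * if x m = a then 1 else 0,
    fun a => Finset.sum_nonneg fun m _ => by positivity, ?_⟩
  have : (M : ℝ) ≠ 0 := by exact_mod_cast hM.ne'
  rw [Finset.sum_comm]
  simp [this]

theorem sum_empirical_mul {M : ℕ} (hM : 0 < M) (x : Fin M → X) (g : X → ℝ) :
    ∑ a, empirical hM x a * g a = (M : ℝ)⁻¹ * ∑ m, g (x m) := by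
  classical
  have (a : X) : empirical hM x a = ∑ m, (M : ℝ)⁻¹ * if x m = a then 1 else 0 := by
    change (fun a => ∑ m, (M : ℝ)⁻¹ * if x m = a then 1 else 0) a = _
    refine Finset.sum_congr rfl fun m _ => ?_
    congr
  simp_rw [this, Finset.sum_mul]
  rw [Finset.sum_comm, Finset.mul_sum]
  simp

/-- With `q i` the output distribution at position `i` under a uniform message, the divergence of
the codeword outputs from `∏ q i` is additive over positions. Its average over messages at position
`i` is the mutual information of the empirical input distribution, hence at most the capacity. -/
theorem HasCode.converse (hW : 0 < capacity W) {n M : ℕ} {ε : ℝ} (hM : 0 < M)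
    (h : HasCode W n M ε) : (1 - ε) * Real.logb 2 M - 1 ≤ n * capacity W := by
  classical
  obtain ⟨x, D, hD, hε⟩ := h
  have hM' : (0 : ℝ) < M := by exact_mod_cast hM
  set P : Fin n → stdSimplex ℝ X := fun i => empirical hM fun m => x m i
  set q : Fin n → Y → ℝ := fun i b => ∑ a, P i a * W a b
  have hq (i b) : q i b = (M : ℝ)⁻¹ * ∑ m, W (x m i) b := sum_empirical_mul hM _ fun a => W a b
  have hq0 (i b) : 0 ≤ q i b :=
    Finset.sum_nonneg fun a _ => mul_nonneg (stdSimplex.zero_le _ _) (stdSimplex.zero_le _ _)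
  have hq1 (i) : ∑ b, q i b = 1 := by
    rw [Finset.sum_comm]
    simp [← Finset.mul_sum]
  have hWq (m i b) (h : W (x m i) b ≠ 0) : q i b ≠ 0 := by
    rw [hq]
    have : 0 < ∑ m, W (x m i) b :=
      Finset.sum_pos' (fun m _ => stdSimplex.zero_le _ _)
        ⟨m, Finset.mem_univ _, lt_of_le_of_ne (stdSimplex.zero_le _ _) h.symm⟩
    positivity
  have hdiv : ∑ m, ∑ y, memoryless W (x m) y *
      Real.logb 2 (memoryless W (x m) y / ∏ i, q i (y i)) ≤ (n * capacity W) * M := by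
    have hm (m) : ∑ y, memoryless W (x m) y *
        Real.logb 2 (memoryless W (x m) y / ∏ i, q i (y i)) =
        ∑ i, ∑ b, W (x m i) b * Real.logb 2 (W (x m i) b / q i b) :=
      sum_prod_mul_logb_prod (fun i b => W (x m i) b) q (fun i => stdSimplex.sum_eq_one _) (hWq m)
    simp_rw [hm]
    rw [Finset.sum_comm]
    have h2 (i) : ∑ m, ∑ b, W (x m i) b * Real.logb 2 (W (x m i) b / q i b) ≤
        M * capacity W := by
      have h3 := mutualInfo_le_capacity hW (P i)
      have h4 : mutualInfo (P i) W =
          (M : ℝ)⁻¹ * ∑ m, ∑ b, W (x m i) b * Real.logb 2 (W (x m i) b / q i b) := by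
        rw [← sum_empirical_mul hM (fun m => x m i)
          fun a => ∑ b, W a b * Real.logb 2 (W a b / q i b)]
        simp only [mutualInfo, Finset.mul_sum, mul_assoc]
        rfl
      rw [h4, inv_mul_le_iff₀ hM'] at h3
      exact h3
    refine (Finset.sum_le_sum fun i _ => h2 i).trans (le_of_eq ?_)
    simp
    ring
  have hmain := sub_one_mul_le_sum_divergence (ε := ε) hM (fun m y => memoryless W (x m) y)
    (fun y => ∏ i, q i (y i)) (fun m y => memoryless_nonneg W _ _) (fun m => sum_memoryless W _)
    (fun y => Finset.prod_nonneg fun i _ => hq0 _ _)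
    (by rw [← Fintype.prod_sum q]; simp [hq1])
    (fun m y h => by
      simp only [memoryless, ne_eq, Finset.prod_eq_zero_iff, not_exists, not_and] at h ⊢
      exact fun i hi => hWq m i _ (h i hi))
    (fun m => Finset.univ.filter (· ∈ D m))
    (fun i j hij => by
      rw [Finset.disjoint_filter]
      exact fun y _ h1 h2 => Set.disjoint_left.1 (hD i j hij) h1 h2)
    (fun m => by
      have h1 := outputProb_add_compl W (x m) (D m)
      have h2 := hε m
      rw [Finset.sum_filter]
      have h3 : outputProb W (x m) (D m) =
          ∑ y, if y ∈ D m then memoryless W (x m) y else 0 := by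
        unfold outputProb
        exact Finset.sum_congr rfl fun y _ => by congr
      linarith)
  exact le_of_mul_le_mul_right (hmain.trans hdiv) hM'

end Channel

/-! ### Achievability -/

open Classical in
/-- Feinstein's greedy construction of a code with small maximal error probability. -/
theorem exists_code_of_greedy {A B : Type*} [Fintype A] [Fintype B] (V : A → B → ℝ)
    (hV : ∀ a b, 0 ≤ V a b) (hV1 : ∀ a, ∑ b, V a b = 1) (P : A → ℝ) (hP : ∀ a, 0 ≤ P a)
    (hP1 : ∑ a, P a = 1) (G : A → Set B) {κ c : ℝ} (hκ : 0 ≤ κ)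
    (hG : ∀ a, ∀ b ∈ G a, ∑ a', P a' * V a' b ≤ κ * V a b) (M : ℕ)
    (hc : (∑ a, P a * ∑ b, if b ∈ (G a)ᶜ then V a b else 0) + M * κ ≤ c) :
    ∃ (x : Fin M → A) (D : Fin M → Set B), (∀ i j, i ≠ j → Disjoint (D i) (D j)) ∧
      (∀ i, D i ⊆ G (x i)) ∧ ∀ i, (∑ b, if b ∈ (D i)ᶜ then V (x i) b else 0) ≤ c := by
  induction M with
  | zero => exact ⟨fun i => i.elim0, fun i => i.elim0, fun i => i.elim0, fun i => i.elim0,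
      fun i => i.elim0⟩
  | succ k ih =>
    push_cast at hc
    obtain ⟨x, D, hD, hDG, hx⟩ := ih (by linarith)
    set U : Set B := ⋃ i, D i with hU
    set Q : B → ℝ := fun b => ∑ a, P a * V a b with hQ
    have hQ0 (b) : 0 ≤ Q b := Finset.sum_nonneg fun a _ => mul_nonneg (hP a) (hV a b)
    -- Each region used so far lies in `G (x i)`, where `Q ≤ κ * V (x i)`, so its `Q`-mass is at
    -- most `κ`.
    have hQU : ∑ b, (if b ∈ U then Q b else 0) ≤ k * κ := by
      calc ∑ b, (if b ∈ U then Q b else 0)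
          ≤ ∑ b, ∑ i, (if b ∈ D i then κ * V (x i) b else 0) := by
            refine Finset.sum_le_sum fun b _ => ?_
            have h0 : ∀ i ∈ Finset.univ, 0 ≤ (if b ∈ D i then κ * V (x i) b else 0) := by
              intro i _
              split_ifs
              exacts [mul_nonneg hκ (hV _ _), le_rfl]
            split_ifs with hb
            · obtain ⟨i, hi⟩ := Set.mem_iUnion.1 hb
              refine le_trans ?_ (Finset.single_le_sum h0 (Finset.mem_univ i))
              rw [if_pos hi]
              exact hG _ _ (hDG i hi)
            · exact Finset.sum_nonneg h0
        _ = ∑ i, ∑ b, (if b ∈ D i then κ * V (x i) b else 0) := Finset.sum_comm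
        _ ≤ ∑ i : Fin k, κ := by
            refine Finset.sum_le_sum fun i _ => ?_
            have : ∑ b, κ * V (x i) b = κ := by rw [← Finset.mul_sum, hV1, mul_one]
            refine le_trans (Finset.sum_le_sum fun b _ => ?_) this.le
            split_ifs
            exacts [le_rfl, mul_nonneg hκ (hV _ _)]
        _ = k * κ := by simp
    -- The next word decodes on what the earlier regions left of `G a`. Averaged over `P`, its error
    -- is at most the atypical mass plus `Q(U)`, hence at most `c`; some word does no worse than the
    -- average.
    obtain ⟨a, ha⟩ : ∃ a, (∑ b, if b ∈ (G a \ U)ᶜ then V a b else 0) ≤ c := by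
      by_contra! hcon
      have h1 : ∑ a, P a * (∑ b, if b ∈ (G a \ U)ᶜ then V a b else 0) ≤ c := by
        have h2 (a) : (∑ b, if b ∈ (G a \ U)ᶜ then V a b else 0) ≤
            (∑ b, if b ∈ (G a)ᶜ then V a b else 0) + ∑ b, if b ∈ U then V a b else 0 := by
          rw [← Finset.sum_add_distrib]
          refine Finset.sum_le_sum fun b _ => ?_
          have := hV a b
          by_cases h3 : b ∈ G a <;> by_cases h4 : b ∈ U <;> simp [h3, h4, this]
        have h3 : ∑ a, P a * (∑ b, if b ∈ U then V a b else 0) =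
            ∑ b, (if b ∈ U then Q b else 0) := by
          simp_rw [Finset.mul_sum]
          rw [Finset.sum_comm]
          refine Finset.sum_congr rfl fun b _ => ?_
          split_ifs <;> simp [hQ]
        calc _ ≤ ∑ a, P a * ((∑ b, if b ∈ (G a)ᶜ then V a b else 0) +
              ∑ b, if b ∈ U then V a b else 0) :=
            Finset.sum_le_sum fun a _ => mul_le_mul_of_nonneg_left (h2 a) (hP a)
          _ ≤ c := by
            simp_rw [mul_add, Finset.sum_add_distrib]
            rw [h3]
            linarith
      obtain ⟨a, ha⟩ : ∃ a, 0 < P a := by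
        by_contra! h
        linarith [Finset.sum_nonpos fun a (_ : a ∈ Finset.univ) => h a]
      have h2 : ∑ a, P a * c < ∑ a, P a * (∑ b, if b ∈ (G a \ U)ᶜ then V a b else 0) :=
        Finset.sum_lt_sum (fun a _ => mul_le_mul_of_nonneg_left (hcon a).le (hP a))
          ⟨a, Finset.mem_univ _, mul_lt_mul_of_pos_left (hcon a) ha⟩
      rw [← Finset.sum_mul, hP1] at h2
      linarith
    have hdisj (i) : Disjoint (G a \ U) (D i) :=
      Set.disjoint_left.2 fun b hb hi => hb.2 (Set.mem_iUnion.2 ⟨i, hi⟩)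
    refine ⟨Fin.cons a x, Fin.cons (G a \ U) D, ?_, ?_, ?_⟩
    · intro i j
      refine Fin.cases ?_ (fun i => ?_) i <;> refine Fin.cases ?_ (fun j => ?_) j
      · simp
      · intro _; simpa using hdisj j
      · intro _; simpa using (hdisj i).symm
      · intro hij; simpa using hD i j (by simpa using hij)
    · intro i
      refine Fin.cases ?_ (fun i => ?_) i
      · simp
      · simpa using hDG i
    · intro i
      refine Fin.cases ?_ (fun i => ?_) i
      · simpa only [Fin.cons_zero] using ha
      · simpa only [Fin.cons_succ] using hx i

theorem exists_pos_lt_of_hasDerivAt_neg {f : ℝ → ℝ} {f' : ℝ} (h : HasDerivAt f f' 0)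
    (hf : f' < 0) : ∃ s, 0 < s ∧ f s < f 0 := by
  have h1 := (hasDerivAt_iff_tendsto_slope.1 h).eventually (gt_mem_nhds hf)
  have h2 : ∀ᶠ s in 𝓝[>] (0 : ℝ), slope f 0 s < 0 :=
    h1.filter_mono (nhdsWithin_mono _ fun s hs => ne_of_gt hs)
  obtain ⟨s, hs, hs0⟩ := (h2.and self_mem_nhdsWithin).exists
  refine ⟨s, hs0, ?_⟩
  rw [slope_def_field, div_lt_iff₀ (by simpa using hs0)] at hs
  linarith

section Channel

variable {X : Type v} {Y : Type w} [Fintype X] [Fintype Y] {W : X → stdSimplex ℝ Y}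

/-- The exponential moment of the information density has a value below one. -/
theorem exists_moment_lt_one {P : stdSimplex ℝ X} {T : ℝ} (hT : T < mutualInfo P W) :
    ∃ s : ℝ, 0 < s ∧
      ∑ x, ∑ y, P x * W x y * ((2 : ℝ) ^ T * (∑ x', P x' * W x' y) / W x y) ^ s < 1 := by
  set Q : Y → ℝ := fun y => ∑ x', P x' * W x' y
  have hsum : ∑ x, ∑ y, P x * W x y = 1 := by simp [← Finset.mul_sum]
  have hlog : Real.log ((2 : ℝ) ^ T) = T * Real.log 2 := Real.log_rpow two_pos T
  have hd (x y) : HasDerivAt (fun s : ℝ => P x * W x y * ((2 : ℝ) ^ T * Q y / W x y) ^ s)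
      (P x * W x y * (T - Real.logb 2 (W x y / Q y)) * Real.log 2) 0 := by
    rcases eq_or_ne (P x * W x y) 0 with h0 | h0
    · simpa [h0] using hasDerivAt_const (0 : ℝ) (0 : ℝ)
    · have hPW : 0 < P x * W x y := lt_of_le_of_ne
        (mul_nonneg (stdSimplex.zero_le _ _) (stdSimplex.zero_le _ _)) h0.symm
      have hW0 : 0 < W x y := lt_of_le_of_ne (stdSimplex.zero_le _ _) (right_ne_zero_of_mul h0).symm
      have hQ0 : 0 < Q y := Finset.sum_pos'
        (fun a _ => mul_nonneg (stdSimplex.zero_le _ _) (stdSimplex.zero_le _ _))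
        ⟨x, Finset.mem_univ _, hPW⟩
      have h1 := ((Real.hasStrictDerivAt_const_rpow
        (a := (2 : ℝ) ^ T * Q y / W x y) (by positivity) 0).hasDerivAt).const_mul (P x * W x y)
      refine h1.congr_deriv ?_
      rw [Real.rpow_zero, one_mul, mul_assoc (P x * W x y), Real.log_div (by positivity) hW0.ne',
        Real.log_mul (by positivity) hQ0.ne', hlog, Real.logb, Real.log_div hW0.ne' hQ0.ne']
      have : Real.log 2 ≠ 0 := (Real.log_pos one_lt_two).ne'
      field_simp
      ring
  have hD := HasDerivAt.fun_sum (u := Finset.univ) fun x _ =>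
    HasDerivAt.fun_sum (u := Finset.univ) fun y _ => hd x y
  -- The moment equals `1` at `s = 0`, with derivative `(T - I(P, W)) log 2 < 0`, so it dips below
  -- `1` just to the right.
  obtain ⟨s, hs, hlt⟩ := exists_pos_lt_of_hasDerivAt_neg hD (by
    have : ∑ x, ∑ y, P x * W x y * (T - Real.logb 2 (W x y / Q y)) * Real.log 2 =
        (T - mutualInfo P W) * Real.log 2 := by
      simp_rw [← Finset.sum_mul, mul_sub, Finset.sum_sub_distrib, ← Finset.sum_mul, hsum]
      simp [mutualInfo, Q]
    rw [this]
    exact mul_neg_of_neg_of_pos (by linarith) (Real.log_pos one_lt_two))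
  refine ⟨s, hs, ?_⟩
  simpa [hsum] using hlt

open Classical in
/-- Chernoff bound for the lower tail of the information density. -/
theorem sum_atypical_le (P : stdSimplex ℝ X) {t s : ℝ} (ht : 0 < t) (hs : 0 < s) (n : ℕ) :
    ∑ x : Fin n → X, (∏ i, P (x i)) * ∑ y : Fin n → Y,
      (if ¬ ∏ i, (∑ a, P a * W a (y i)) ≤ t⁻¹ ^ n * memoryless W x y
        then memoryless W x y else 0) ≤
      (∑ a, ∑ b, P a * W a b * (t * (∑ a', P a' * W a' b) / W a b) ^ s) ^ n := by
  set Q : Y → ℝ := fun y => ∑ x', P x' * W x' y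
  have hQ0 (b) : 0 ≤ Q b :=
    Finset.sum_nonneg fun a _ => mul_nonneg (stdSimplex.zero_le _ _) (stdSimplex.zero_le _ _)
  have hR : (∑ a, ∑ b, P a * W a b * (t * Q b / W a b) ^ s) ^ n =
      ∑ x : Fin n → X, ∑ y : Fin n → Y,
        ∏ i, (P (x i) * W (x i) (y i) * (t * Q (y i) / W (x i) (y i)) ^ s) := by
    have h1 (x : Fin n → X) :
        ∑ y : Fin n → Y, ∏ i, (P (x i) * W (x i) (y i) * (t * Q (y i) / W (x i) (y i)) ^ s) =
          ∏ i, ∑ b, P (x i) * W (x i) b * (t * Q b / W (x i) b) ^ s :=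
      (Fintype.prod_sum fun i b => P (x i) * W (x i) b * (t * Q b / W (x i) b) ^ s).symm
    simp_rw [h1]
    rw [← Fintype.prod_sum fun (_ : Fin n) a => ∑ b, P a * W a b * (t * Q b / W a b) ^ s]
    simp
  rw [hR]
  refine Finset.sum_le_sum fun x _ => ?_
  rw [Finset.mul_sum]
  refine Finset.sum_le_sum fun y _ => ?_
  have hbase (i) : 0 ≤ t * Q (y i) / W (x i) (y i) :=
    div_nonneg (mul_nonneg ht.le (hQ0 _)) (stdSimplex.zero_le _ _)
  have hP : 0 ≤ ∏ i, P (x i) := Finset.prod_nonneg fun i _ => stdSimplex.zero_le _ _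
  have hV := memoryless_nonneg W x y
  rw [Finset.prod_mul_distrib, Finset.prod_mul_distrib, Real.finsetProd_rpow _ _ fun i _ => hbase i]
  change _ ≤ _ * memoryless W x y * _
  rw [mul_assoc]
  refine mul_le_mul_of_nonneg_left ?_ hP
  have hnn := Real.rpow_nonneg (Finset.prod_nonneg fun i (_ : i ∈ Finset.univ) => hbase i) s
  split_ifs with h
  · exact mul_nonneg hV hnn
  · rcases hV.eq_or_lt with h0 | h0
    · simp [← h0]
    -- On the atypical event the product of the bases exceeds `1`, so its `s`-th power dominates the
    -- indicator; that power factors over positions.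
    · refine le_mul_of_one_le_right hV (Real.one_le_rpow ?_ hs.le)
      have hprod : ∏ i, t * Q (y i) / W (x i) (y i) =
          t ^ n * (∏ i, Q (y i)) / memoryless W x y := by
        rw [Finset.prod_div_distrib, Finset.prod_mul_distrib]
        simp [memoryless]
      rw [hprod, one_le_div h0]
      have h1 := mul_lt_mul_of_pos_left (not_le.1 h) (pow_pos ht n)
      rw [← mul_assoc, ← mul_pow, mul_inv_cancel₀ ht.ne', one_pow, one_mul] at h1
      exact h1.le

/-- Achievability part of the noisy channel coding theorem, for the maximal error probability. -/
theorem exists_hasCode_of_lt_capacity (hW : 0 < capacity W) {R : ℝ} (hR : R < capacity W) :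
    ∃ η : ℕ → ℝ, Tendsto η atTop (𝓝 0) ∧
      ∀ n M : ℕ, 0 < M → Real.logb 2 M ≤ n * R → HasCode W n M (η n) := by
  classical
  have := nonempty_of_capacity_pos hW
  obtain ⟨P, hP⟩ := exists_lt_of_lt_ciSup hR
  obtain ⟨T, hRT, hTP⟩ := exists_between hP
  obtain ⟨s, hs, hρ⟩ := exists_moment_lt_one hTP
  set t : ℝ := (2 : ℝ) ^ T with ht
  have ht0 : 0 < t := by positivity
  set ρ := ∑ x, ∑ y, P x * W x y * (t * (∑ x', P x' * W x' y) / W x y) ^ s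
  have hρ0 : 0 ≤ ρ := Finset.sum_nonneg fun x _ => Finset.sum_nonneg fun y _ =>
    mul_nonneg (mul_nonneg (stdSimplex.zero_le _ _) (stdSimplex.zero_le _ _))
      (Real.rpow_nonneg (div_nonneg (mul_nonneg ht0.le (Finset.sum_nonneg fun a _ =>
        mul_nonneg (stdSimplex.zero_le _ _) (stdSimplex.zero_le _ _))) (stdSimplex.zero_le _ _)) _)
  have hRT' : (2 : ℝ) ^ R * t⁻¹ < 1 := by
    rw [ht, mul_inv_lt_iff₀ (by positivity), one_mul]
    exact Real.rpow_lt_rpow_of_exponent_lt one_lt_two hRT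
  -- The first term bounds the atypical mass; the second bounds `M * κ` with `κ = t⁻¹ ^ n` and `M ≤
  -- 2 ^ (n R)`. It decays because `R < T`.
  refine ⟨fun n => ρ ^ n + ((2 : ℝ) ^ R * t⁻¹) ^ n, ?_, fun n M hM hMR => ?_⟩
  · simpa using (tendsto_pow_atTop_nhds_zero_of_lt_one hρ0 hρ).add
      (tendsto_pow_atTop_nhds_zero_of_lt_one (by positivity) hRT')
  have hMle : (M : ℝ) ≤ ((2 : ℝ) ^ R) ^ n := by
    rw [Real.logb_le_iff_le_rpow one_lt_two (by exact_mod_cast hM)] at hMR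
    rwa [mul_comm, Real.rpow_mul two_pos.le, Real.rpow_natCast] at hMR
  have hQ (y : Fin n → Y) : ∑ x : Fin n → X, (∏ i, P (x i)) * memoryless W x y =
      ∏ i, ∑ a, P a * W a (y i) := by
    rw [Fintype.prod_sum fun i a => P a * W a (y i)]
    simp [memoryless, Finset.prod_mul_distrib]
  obtain ⟨x, D, hD, -, hx⟩ := exists_code_of_greedy (fun x : Fin n → X => memoryless W x)
    (memoryless_nonneg W) (sum_memoryless W) (fun x => ∏ i, P (x i))
    (fun x => Finset.prod_nonneg fun i _ => stdSimplex.zero_le _ _)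
    (by rw [← Fintype.prod_sum fun (_ : Fin n) a => P a]; simp)
    (fun x => {y | ∏ i, (∑ a, P a * W a (y i)) ≤ t⁻¹ ^ n * memoryless W x y})
    (κ := t⁻¹ ^ n) (c := ρ ^ n + ((2 : ℝ) ^ R * t⁻¹) ^ n) (by positivity)
    (fun x y hy => by rw [hQ]; exact hy) M
    (by
      refine add_le_add ?_ ?_
      · simpa only [Set.mem_compl_iff, Set.mem_ofPred_eq] using sum_atypical_le P ht0 hs n
      · rw [mul_pow]
        exact mul_le_mul_of_nonneg_right hMle (by positivity))
  refine ⟨x, D, hD, fun i => ?_⟩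
  unfold outputProb
  convert hx i

end Channel

/-! ### Closures, cores and distortion -/

namespace ProofSystem

variable {U : Type*} (PS : ProofSystem U)

theorem Cn_eq_of_subset_of_subset_Cn {Γ Δ : Set U} (h : Γ ⊆ Δ) (h' : Δ ⊆ PS.Cn Γ) :
    PS.Cn Δ = PS.Cn Γ :=
  Set.Subset.antisymm ((PS.Cn_mono h').trans (PS.Cn_idem Γ).subset) (PS.Cn_mono h)

theorem atom_subset_and_Cn_atom [LinearOrder U] (S : Finset U) :
    PS.atom S ⊆ S ∧ PS.Cn (PS.atom S : Set U) = PS.Cn S := by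
  classical
  unfold atom
  -- The scanning order plays no role here: any list may be scanned from any starting set.
  generalize S.sort (· ≤ ·) = l
  induction l generalizing S with
  | nil => exact ⟨Finset.Subset.refl _, rfl⟩
  | cons s l ih =>
    rw [List.foldl_cons]
    split_ifs with hs
    · obtain ⟨h1, h2⟩ := ih (S.erase s)
      refine ⟨h1.trans (Finset.erase_subset _ _), h2.trans ?_⟩
      refine (PS.Cn_eq_of_subset_of_subset_Cn (by simp) fun t ht => ?_).symm
      by_cases hts : t = s
      · exact hts ▸ hs
      · exact PS.subset_Cn _ (by simpa [hts] using ht)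
    · exact ih S

theorem closureFidelity_eq_one [Finite U] {S T : Set U} (h : PS.Cn S = PS.Cn T) :
    PS.closureFidelity S T = 1 := by
  unfold closureFidelity
  rw [h, Set.union_self, Set.inter_self]
  split_ifs with h0
  · rfl
  · have := (Set.ncard_pos (Set.toFinite (PS.Cn T))).2 (Set.nonempty_iff_ne_empty.2 h0)
    exact div_self (by positivity)

theorem closureFidelity_le_one [Finite U] (S T : Set U) : PS.closureFidelity S T ≤ 1 := by
  unfold closureFidelity
  split_ifs
  · exact le_rfl
  · refine div_le_one_of_le₀ ?_ (Nat.cast_nonneg _)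
    exact_mod_cast Set.ncard_le_ncard (Set.inter_subset_left.trans Set.subset_union_left)
      (Set.toFinite _)

theorem closureDistortion_nonneg [Finite U] (Γ : Set U) (s t : U) :
    0 ≤ PS.closureDistortion Γ s t :=
  sub_nonneg.2 (PS.closureFidelity_le_one _ _)

theorem closureDistortion_self [Finite U] (Γ : Set U) (s : U) :
    PS.closureDistortion Γ s s = 0 := by
  rw [closureDistortion, PS.closureFidelity_eq_one rfl, sub_self]

/-- A message outside a generating subset is reproduced without distortion by any element of that
subset. -/
theorem closureDistortion_eq_zero_of_generating [Finite U] {A Γ : Set U} (hA : A ⊆ Γ)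
    (hCn : PS.Cn A = PS.Cn Γ) {m t : U} (hm : m ∈ Γ) (hmA : m ∉ A) (ht : t ∈ A) :
    PS.closureDistortion Γ m t = 0 := by
  have h1 : Γ \ {m} ∪ {m} = Γ := Set.sdiff_union_of_subset (Set.singleton_subset_iff.2 hm)
  have h2 : A ⊆ Γ \ {m} ∪ {t} := fun a ha => Or.inl ⟨hA ha, fun h => hmA (h ▸ ha)⟩
  have h3 : Γ \ {m} ∪ {t} ⊆ Γ :=
    Set.union_subset Set.sdiff_subset (Set.singleton_subset_iff.2 (hA ht))
  rw [closureDistortion, h1, PS.closureFidelity_eq_one, sub_self]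
  exact Set.Subset.antisymm (hCn ▸ PS.Cn_mono h2) (PS.Cn_mono h3)

end ProofSystem

namespace Scenario

variable {B : Scenario.{u}}

theorem core_subset_sender : B.core ⊆ B.sender := (B.PS.atom_subset_and_Cn_atom _).1

theorem Cn_core : B.PS.Cn (B.core : Set B.State) = B.PS.Cn B.sender :=
  (B.PS.atom_subset_and_Cn_atom _).2

theorem OverlapConditions.core_subset_receiver (h : B.OverlapConditions) (j : Fin B.K) :
    B.core ⊆ B.receiver j := by
  have := Set.sdiff_eq_empty.1 (h.1 j)
  exact_mod_cast this

/-- The receiver lies between the core and the closure of the core. -/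
theorem OverlapConditions.Cn_receiver (h : B.OverlapConditions) (j : Fin B.K) :
    B.PS.Cn (B.receiver j : Set B.State) = B.PS.Cn B.sender := by
  rw [← Cn_core]
  refine B.PS.Cn_eq_of_subset_of_subset_Cn
    (Finset.coe_subset.2 (h.core_subset_receiver j)) fun t ht => ?_
  rw [Cn_core]
  by_cases hs : t ∈ (B.sender : Set B.State)
  · exact B.PS.subset_Cn _ hs
  · exact Set.sdiff_eq_empty.1 (h.2 j) ⟨ht, hs⟩

end Scenario

/-! ### Broadcast codes and channel codes -/

section Codes

variable {X : Type v} {Y : Type w} [Fintype Y] {W : X → stdSimplex ℝ Y}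
  {B : Scenario.{u}} {n : ℕ}

theorem BroadcastCode.outputProb_le_closureError (c : BroadcastCode X Y B n) (j : Fin B.K)
    (m : B.sender) :
    outputProb W (c.enc m)
      {y | 0 < B.PS.closureDistortion B.sender m (c.dec j y : B.receiver j)} ≤
      c.closureError W j :=
  le_ciSup (f := fun m : B.sender => outputProb W (c.enc m)
    {y | 0 < B.PS.closureDistortion B.sender m (c.dec j y : B.receiver j)})
    (Set.finite_range _).bddAbove m

theorem BroadcastCode.closureError_nonneg (c : BroadcastCode X Y B n) (j : Fin B.K) :
    0 ≤ c.closureError W j :=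
  Real.iSup_nonneg fun _ => outputProb_nonneg W _ _

/-- Under core-disjointness, any broadcast code induces a channel code for the core. -/
theorem BroadcastCode.hasCode (h : B.CoreDisjoint) (c : BroadcastCode X Y B n) {ε : ℝ}
    (hc : ∀ j, c.closureError W j ≤ ε) : HasCode W n B.core.card ε := by
  -- One receiver suffices, and `K ≥ 1` provides it.
  let j : Fin B.K := ⟨0, B.one_le_K⟩
  let e := B.core.equivFin
  refine ⟨fun i => c.enc ⟨e.symm i, Scenario.core_subset_sender (e.symm i).2⟩,
    fun i => {y | (c.dec j y : B.State) ∈ B.zeroDistortion j (e.symm i)}, ?_, fun i => ?_⟩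
  · intro i i' hii
    have hne : (e.symm i : B.State) ≠ e.symm i' := fun h =>
      hii (e.symm.injective (Subtype.ext h))
    exact Set.disjoint_left.2 fun y hy hy' =>
      Set.disjoint_left.1 (h j _ (e.symm i).2 _ (e.symm i').2 hne) hy hy'
  · refine le_trans (outputProb_mono W _ ?_) ((c.outputProb_le_closureError j _).trans (hc j))
    intro y hy
    refine lt_of_le_of_ne (B.PS.closureDistortion_nonneg _ _ _) fun h0 => hy ?_
    exact ⟨(c.dec j y).2, h0.symm⟩

/-- A channel code for the core extends to a two-layer broadcast code. -/
theorem HasCode.exists_isTwoLayer (hB : B.OverlapConditions) (hne : B.core.Nonempty) {ε : ℝ}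
    (h : HasCode W n B.core.card ε) :
    ∃ c : BroadcastCode X Y B n, c.IsTwoLayer ∧ ∀ j, c.closureError W j ≤ ε := by
  classical
  obtain ⟨x, D, hD, hε⟩ := h
  let e := B.core.equivFin
  obtain ⟨a, ha⟩ := hne
  let a₀ : B.core := ⟨a, ha⟩
  have hε0 : 0 ≤ ε := (outputProb_nonneg W _ _).trans (hε (e a₀))
  let fA : B.core → (Fin n → X) := fun b => x (e b)
  let gA : (Fin n → Y) → B.core := fun y =>
    if h : ∃ i, y ∈ D i then e.symm h.choose else a₀
  have hgA (b : B.core) (y : Fin n → Y) (hy : y ∈ D (e b)) : gA y = b := by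
    have hex : ∃ i, y ∈ D i := ⟨_, hy⟩
    have : hex.choose = e b := by
      by_contra hne
      exact Set.disjoint_left.1 (hD _ _ hne) hex.choose_spec hy
    simp only [gA, dif_pos hex, this, Equiv.symm_apply_apply]
  let c : BroadcastCode X Y B n :=
    { enc := fun m => if h : m.1 ∈ B.core then fA ⟨m.1, h⟩ else fA a₀
      dec := fun j y => ⟨gA y, hB.core_subset_receiver j (gA y).2⟩ }
  refine ⟨c, ⟨fA, gA, a₀, fun m => rfl, fun j y => rfl⟩, fun j => ?_⟩
  refine Real.iSup_le (fun m => ?_) hε0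
  by_cases hm : m.1 ∈ B.core
  · have henc : c.enc m = x (e ⟨m.1, hm⟩) := dif_pos hm
    rw [henc]
    refine (outputProb_mono W _ fun y hy hyD => ?_).trans (hε _)
    have hdec : ((c.dec j y : B.receiver j) : B.State) = m.1 :=
      congrArg Subtype.val (hgA ⟨m.1, hm⟩ y hyD)
    have hy' : 0 < B.PS.closureDistortion B.sender m.1 (c.dec j y : B.receiver j) := hy
    rw [hdec, B.PS.closureDistortion_self] at hy'
    exact lt_irrefl _ hy'
  -- Outside the core no error can occur, whatever the channel does: every decoded value is a core
  -- element.
  · have : {y | 0 < B.PS.closureDistortion B.sender m (c.dec j y : B.receiver j)} = ∅ := by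
      refine Set.eq_empty_of_forall_notMem fun y hy => ?_
      have h0 := B.PS.closureDistortion_eq_zero_of_generating (A := B.core)
        (Finset.coe_subset.2 Scenario.core_subset_sender) Scenario.Cn_core m.2
        (by simpa using hm) (gA y).2
      have hy' : 0 < B.PS.closureDistortion B.sender m.1 (gA y : B.State) := hy
      exact hy'.ne' h0
    rw [this]
    simpa [outputProb] using hε0

end Codes

/-! ### Rates and minimum blocklength -/

section Blocklength

variable {X : Type v} {Y : Type w} [Fintype Y] {W : X → stdSimplex ℝ Y}
  {B : Scenario.{u}}

/-- The right-hand side sees the scenario only through the size of its core, which is why the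
minimum blocklength ignores the number of receivers. -/
theorem achievableBlocklengths_eq (hB : B.OverlapConditions) (hne : B.core.Nonempty)
    (hd : B.CoreDisjoint) (ε : ℝ) :
    achievableBlocklengths W B ε = {n | HasCode W n B.core.card ε} := by
  ext n
  constructor
  · rintro ⟨c, hc⟩
    exact c.hasCode hd hc
  · intro h
    obtain ⟨c, -, hc⟩ := HasCode.exists_isTwoLayer hB hne h
    exact ⟨c, hc⟩

variable [Fintype X]

theorem logb_card_le (hW : 0 < capacity W) (hB : B.CoreDisjoint) {n : ℕ}
    (c : BroadcastCode X Y B n) {ε : ℝ} (hε : ε < 1) (hc : ∀ j, c.closureError W j ≤ ε) :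
    Real.logb 2 B.core.card ≤ (n * capacity W + 1) / (1 - ε) := by
  rw [le_div_iff₀ (by linarith)]
  -- For an empty core the logarithm takes its default value `0`.
  rcases Nat.eq_zero_or_pos B.core.card with h | h
  · simp only [h, Nat.cast_zero, Real.logb_zero, zero_mul]
    positivity
  · linarith [(c.hasCode hB hc).converse hW h]

theorem exists_uniform_codes (hW : 0 < capacity W) {R : ℝ} (hR : R < capacity W) :
    ∃ η : ℕ → ℝ, Tendsto η atTop (𝓝 0) ∧
      ∀ n : ℕ, 0 < n → ∀ B : Scenario.{u}, B.OverlapConditions → B.core.Nonempty →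
        Real.logb 2 B.core.card / n ≤ R →
        ∃ c : BroadcastCode X Y B n, c.IsTwoLayer ∧ ∀ j, c.closureError W j ≤ η n := by
  obtain ⟨η, hη, hcode⟩ := exists_hasCode_of_lt_capacity hW hR
  refine ⟨η, hη, fun n hn B hB hne hR => ?_⟩
  refine HasCode.exists_isTwoLayer hB hne (hcode n _ hne.card_pos ?_)
  rwa [div_le_iff₀ (by exact_mod_cast hn), mul_comm] at hR

/-- This fills the blocklengths at which no reliable code is guaranteed. Empty decoding regions form
a channel code at error level `1`. -/
theorem exists_isTwoLayer (hW : 0 < capacity W) (hB : B.OverlapConditions)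
    (hne : B.core.Nonempty) (n : ℕ) : ∃ c : BroadcastCode X Y B n, c.IsTwoLayer := by
  have := nonempty_of_capacity_pos hW
  obtain ⟨P⟩ := this
  have hX : Nonempty X := by
    by_contra h
    rw [not_nonempty_iff] at h
    simpa using stdSimplex.sum_eq_one P
  obtain ⟨a⟩ := hX
  obtain ⟨c, hc, -⟩ := HasCode.exists_isTwoLayer (W := W) (n := n) (ε := 1) hB hne
    ⟨fun _ _ => a, fun _ => ∅, fun _ _ _ => by simp, fun i => by
      have h1 := outputProb_add_compl W (fun _ : Fin n => a) ∅
      have h2 := outputProb_nonneg W (fun _ : Fin n => a) ∅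
      linarith⟩
  exact ⟨c, hc⟩

theorem exists_reliable_sequence (hW : 0 < capacity W) (hB : B.OverlapConditions)
    (hne : B.core.Nonempty) :
    ∃ c : (n : ℕ) → BroadcastCode X Y B n, (∀ n, (c n).IsTwoLayer) ∧
      ∀ j, Tendsto (fun n => (c n).closureError W j) atTop (𝓝 0) := by
  -- The rate of a fixed core tends to `0`, so any rate strictly between `0` and the capacity would
  -- do.
  obtain ⟨η, hη, hcode⟩ := exists_uniform_codes.{u} hW (half_lt_self hW)
  have hlim : Tendsto (fun n : ℕ => Real.logb 2 B.core.card / n) atTop (𝓝 0) :=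
    tendsto_const_div_atTop_nhds_zero_nat _
  have hev : ∀ᶠ n : ℕ in atTop, ∃ c : BroadcastCode X Y B n, c.IsTwoLayer ∧
      ∀ j, c.closureError W j ≤ η n := by
    filter_upwards [hlim.eventually (ge_mem_nhds (half_pos hW)), eventually_gt_atTop 0] with n h1 h2
    exact hcode n h2 B hB hne h1
  have hex (n : ℕ) : ∃ c : BroadcastCode X Y B n, c.IsTwoLayer ∧
      ((∃ c : BroadcastCode X Y B n, c.IsTwoLayer ∧ ∀ j, c.closureError W j ≤ η n) →
        ∀ j, c.closureError W j ≤ η n) := by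
    by_cases h : ∃ c : BroadcastCode X Y B n, c.IsTwoLayer ∧ ∀ j, c.closureError W j ≤ η n
    · obtain ⟨c, hc1, hc2⟩ := h
      exact ⟨c, hc1, fun _ => hc2⟩
    · obtain ⟨c, hc⟩ := exists_isTwoLayer hW hB hne n
      exact ⟨c, hc, fun h' => absurd h' h⟩
  choose c hc1 hc2 using hex
  refine ⟨c, hc1, fun j => ?_⟩
  refine tendsto_of_tendsto_of_tendsto_of_le_of_le' tendsto_const_nhds hη
    (Eventually.of_forall fun n => (c n).closureError_nonneg j) ?_
  filter_upwards [hev] with n hn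
  exact hc2 n hn j

theorem achievableBlocklengths_nonempty (hW : 0 < capacity W) {ε : ℝ} (hε : 0 < ε)
    (hB : B.OverlapConditions) (hne : B.core.Nonempty) :
    (achievableBlocklengths W B ε).Nonempty := by
  obtain ⟨c, -, hc⟩ := exists_reliable_sequence hW hB hne
  obtain ⟨n, hn⟩ := (eventually_all.2 fun j => (hc j).eventually (ge_mem_nhds hε)).exists
  exact ⟨n, c n, hn⟩

theorem exists_minBlocklength_le (hW : 0 < capacity W) {ε δ : ℝ} (hε : 0 < ε) (hδ : 0 < δ)
    (hδC : δ < capacity W) :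
    ∃ L : ℕ, ∀ B : Scenario.{u}, B.OverlapConditions → B.core.Nonempty → L ≤ B.core.card →
      minBlocklength W B ε ≤ ⌈Real.logb 2 B.core.card / (capacity W - δ)⌉₊ := by
  obtain ⟨η, hη, hcode⟩ := exists_uniform_codes.{u} hW (R := capacity W - δ) (by linarith)
  have hCδ : 0 < capacity W - δ := by linarith
  -- A large core makes this blocklength large, which brings `η` below `ε` uniformly in the
  -- scenario.
  have hlim : Tendsto (fun M : ℕ => ⌈Real.logb 2 M / (capacity W - δ)⌉₊) atTop atTop :=
    tendsto_nat_ceil_atTop.comp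
      (((Real.tendsto_logb_atTop one_lt_two).comp tendsto_natCast_atTop_atTop).atTop_div_const hCδ)
  obtain ⟨L, hL⟩ := eventually_atTop.1
    ((hlim.eventually (hη.eventually (ge_mem_nhds hε))).and
      (hlim.eventually (eventually_gt_atTop 0)))
  refine ⟨L, fun B hB hne hcard => ?_⟩
  obtain ⟨h1, h2⟩ := hL _ hcard
  obtain ⟨c, -, hc⟩ := hcode _ h2 B hB hne (by
    rw [div_le_iff₀ (by exact_mod_cast h2), mul_comm, ← div_le_iff₀ hCδ]
    exact Nat.le_ceil _)
  exact Nat.sInf_le ⟨c, fun j => (hc j).trans h1⟩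

theorem le_minBlocklength (hW : 0 < capacity W) {ε : ℝ} (hε : 0 < ε)
    (hB : B.OverlapConditions) (hne : B.core.Nonempty) (hd : B.CoreDisjoint) :
    ((1 - ε) * Real.logb 2 B.core.card - 1) / capacity W ≤ minBlocklength W B ε := by
  obtain ⟨c, hc⟩ := Nat.sInf_mem (achievableBlocklengths_nonempty (W := W) hW hε hB hne)
  rw [div_le_iff₀ hW]
  exact (c.hasCode hd hc).converse hW hne.card_pos

theorem exists_abs_minBlocklength_ratio_sub_one_le (hW : 0 < capacity W) {γ : ℝ} (hγ : 0 < γ) :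
    ∃ ε₀ : ℝ, 0 < ε₀ ∧ ∀ ε : ℝ, 0 < ε → ε < ε₀ → ∃ L : ℕ,
      ∀ B : Scenario.{u}, B.OverlapConditions → B.CoreDisjoint → L ≤ B.core.card →
        |minBlocklength W B ε / (Real.logb 2 B.core.card / capacity W) - 1| ≤ γ := by
  set C := capacity W with hC
  refine ⟨γ / 2, by positivity, fun ε hε hε0 => ?_⟩
  have hεγ : ε < γ / 2 := hε0
  -- Chosen so that `C / (C - δ) = 1 + γ / 2`.
  set δ := C * (γ / (2 + γ)) with hδ
  have hfrac : γ / (2 + γ) < 1 := by rw [div_lt_one (by positivity)]; linarith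
  have hδ0 : 0 < δ := by positivity
  have hδC : δ < C := by nlinarith
  obtain ⟨L, hL⟩ := exists_minBlocklength_le.{u} hW hε hδ0 hδC
  have hlim : Tendsto (fun M : ℕ => Real.logb 2 M) atTop atTop :=
    (Real.tendsto_logb_atTop one_lt_two).comp tendsto_natCast_atTop_atTop
  -- The other half of `γ` absorbs the additive losses: the bit lost in the converse and the
  -- rounding up, which costs at most `C` after scaling.
  obtain ⟨L', hL'⟩ := eventually_atTop.1
    (hlim.eventually (eventually_ge_atTop (max 1 ((2 / γ) * max 1 C))))
  refine ⟨max (max L L') 1, fun B hB hd hcard => ?_⟩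
  have hne : B.core.Nonempty := Finset.card_pos.1 (by omega)
  have hup := hL B hB hne (by omega)
  have hlow := le_minBlocklength hW hε hB hne hd
  have hlog := hL' B.core.card (by omega)
  set l := Real.logb 2 B.core.card
  set N := minBlocklength W B ε
  have hl1 : 1 ≤ l := (le_max_left _ _).trans hlog
  have hl0 : 0 < l := by linarith
  have hl2 : max 1 C ≤ γ / 2 * l := by
    have := (le_max_right _ _).trans hlog
    rw [div_mul_eq_mul_div, div_le_iff₀ hγ] at this
    linarith
  have hl3 := (le_max_left _ _).trans hl2
  have hl4 := (le_max_right _ _).trans hl2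
  have hup' : (N : ℝ) * C ≤ (1 + γ / 2) * l + C := by
    have h1 : (N : ℝ) ≤ l / (C - δ) + 1 :=
      (Nat.cast_le.2 hup).trans (Nat.ceil_lt_add_one (by
        exact div_nonneg hl0.le (by linarith))).le
    have h2 : l / (C - δ) * C = (1 + γ / 2) * l := by
      have : C - δ = C * (2 / (2 + γ)) := by rw [hδ]; field_simp; ring
      rw [this]
      field_simp
    nlinarith [mul_le_mul_of_nonneg_right h1 hW.le]
  rw [div_le_iff₀ hW] at hlow
  have heq : (N : ℝ) / (l / C) - 1 = (N * C - l) / l := by field_simp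
  rw [heq, abs_le, le_div_iff₀ hl0, div_le_iff₀ hl0]
  constructor
  · nlinarith
  · nlinarith

end Blocklength

end SemanticBroadcast

theorem mainTheorem11 {X : Type v} {Y : Type w} [Fintype X] [Fintype Y]
    (W : X → stdSimplex ℝ Y) (hW : 0 < capacity W) :
    -- (i) simultaneous closure fidelity
    (∀ B : Scenario.{u}, B.OverlapConditions →
      ∀ j, B.PS.closureFidelity B.sender (B.receiver j) = 1) ∧
    -- (ii) achievability by a single sequence of codes for a fixed scenario
    (∀ B : Scenario.{u}, B.OverlapConditions → B.core.Nonempty →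
      ∃ c : (n : ℕ) → BroadcastCode X Y B n, (∀ n, (c n).IsTwoLayer) ∧
        ∀ j, Tendsto (fun n => (c n).closureError W j) atTop (𝓝 0)) ∧
    -- (ii) achievability at every rate below capacity, uniformly in the scenario
    (∀ R : ℝ, R < capacity W → ∃ η : ℕ → ℝ, Tendsto η atTop (𝓝 0) ∧
      ∀ n : ℕ, 0 < n → ∀ B : Scenario.{u}, B.OverlapConditions → B.core.Nonempty →
        Real.logb 2 B.core.card / n ≤ R →
        ∃ c : BroadcastCode X Y B n, c.IsTwoLayer ∧ ∀ j, c.closureError W j ≤ η n) ∧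
    -- (iii) the minimum blocklength exists and is at most about `log |A| / C(W)` ...
    (∀ ε : ℝ, 0 < ε → ε < 1 →
      (∀ B : Scenario.{u}, B.OverlapConditions → B.core.Nonempty →
        (achievableBlocklengths W B ε).Nonempty) ∧
      (∀ δ : ℝ, 0 < δ → δ < capacity W → ∃ L : ℕ, ∀ B : Scenario.{u},
        B.OverlapConditions → B.core.Nonempty → L ≤ B.core.card →
        minBlocklength W B ε ≤ ⌈Real.logb 2 B.core.card / (capacity W - δ)⌉₊) ∧
      -- ... at least about `log |A| / C(W)` ...
      (∀ B : Scenario.{u}, B.OverlapConditions → B.core.Nonempty → B.CoreDisjoint →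
        ((1 - ε) * Real.logb 2 B.core.card - 1) / capacity W ≤ minBlocklength W B ε) ∧
      -- ... and depends only on `|A|`, hence not on the number of receivers
      (∀ B B' : Scenario.{u}, B.OverlapConditions → B.core.Nonempty → B.CoreDisjoint →
        B'.OverlapConditions → B'.core.Nonempty → B'.CoreDisjoint →
        B.core.card = B'.core.card → minBlocklength W B ε = minBlocklength W B' ε)) ∧
    (∀ γ : ℝ, 0 < γ → ∃ ε₀ : ℝ, 0 < ε₀ ∧ ∀ ε : ℝ, 0 < ε → ε < ε₀ → ∃ L : ℕ,
      ∀ B : Scenario.{u}, B.OverlapConditions → B.CoreDisjoint → L ≤ B.core.card →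
        |minBlocklength W B ε / (Real.logb 2 B.core.card / capacity W) - 1| ≤ γ) ∧
    -- (iv) converse
    (∀ B : Scenario.{u}, B.OverlapConditions → B.CoreDisjoint →
      ∀ (n : ℕ) (c : BroadcastCode X Y B n) (ε : ℝ), ε < 1 →
        (∀ j, c.closureError W j ≤ ε) →
        Real.logb 2 B.core.card ≤ (n * capacity W + 1) / (1 - ε)) := by
  refine ⟨fun B hB j => B.PS.closureFidelity_eq_one (hB.Cn_receiver j).symm,
    fun B hB hne => exists_reliable_sequence hW hB hne,
    fun R hR => exists_uniform_codes hW hR,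
    fun ε hε _ => ⟨fun B hB hne => achievableBlocklengths_nonempty hW hε hB hne,
      fun δ hδ hδC => exists_minBlocklength_le hW hε hδ hδC,
      fun B hB hne hd => le_minBlocklength hW hε hB hne hd, ?_⟩,
    fun γ hγ => exists_abs_minBlocklength_ratio_sub_one_le hW hγ,
    fun B _ hd n c ε hε hc => logb_card_le hW hd c hε hc⟩
  intro B B' hB hne hd hB' hne' hd' hcard
  rw [minBlocklength, minBlocklength, achievableBlocklengths_eq hB hne hd,
    achievableBlocklengths_eq hB' hne' hd', hcard]
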